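/- Let $n\ge 0$ be an integer. Identify the pair $(i,j)\in\mathbb Z^2$ with the unit square $[i,i+1]\times[j,j+1]$ of the plane. The Aztec diamond of order $n$ is the set of unit squares obtained by taking the triangular array of squares $(i,j)$ with $i,j\ge 0$ and $i+j<n$, and completing it with its mirror images in the two coordinate axes. A domino is a set of two distinct squares that share an edge, and a domino tiling of a set of squares is a partition of it into dominoes. **Aztec diamond theorem.** There are exactly $2^{\binom{n+1}{2}}$ domino tilings of the Aztec diamond of order $n$. -/

import Mathlib

/-- A unit square of the square grid in the plane: the pair `(i, j)` stands for the square
`[i, i + 1] × [j, j + 1]`. -/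
abbrev GridSquare : Type := ℤ × ℤ

/-- The triangular array of squares of side `n` in the first quadrant, aligned against the two
coordinate axes: rows of `n, n - 1, …, 1` squares. -/
def triangularArray (n : ℕ) : Set GridSquare :=
  {p | 0 ≤ p.1 ∧ 0 ≤ p.2 ∧ p.1 + p.2 < n}

/-- The reflection `x ↦ -x` of the plane maps the square with lower left corner `(i, j)` to the
one with lower left corner `(-1 - i, j)`. -/
def mirrorX (p : GridSquare) : GridSquare := (-1 - p.1, p.2)

/-- The reflection `y ↦ -y` of the plane, on grid squares. -/
def mirrorY (p : GridSquare) : GridSquare := (p.1, -1 - p.2)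

/-- The Aztec diamond of order `n`: the triangular array of side `n`, completed with its mirror
images in the two axes. -/
def aztecDiamond (n : ℕ) : Set GridSquare :=
  triangularArray n ∪ mirrorX '' triangularArray n ∪
    (mirrorY '' triangularArray n ∪ mirrorY '' (mirrorX '' triangularArray n))

/-- Two grid squares are adjacent if they are distinct and share an edge. -/
def AdjacentSquares (p q : GridSquare) : Prop :=
  |p.1 - q.1| + |p.2 - q.2| = 1

/-- A domino is a set of two adjacent squares. -/
def IsDomino (d : Set GridSquare) : Prop :=
  ∃ p q : GridSquare, AdjacentSquares p q ∧ d = {p, q}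

/-- A domino tiling of a set `S` of squares is a partition of `S` into dominoes. -/
def IsDominoTiling (S : Set GridSquare) (T : Set (Set GridSquare)) : Prop :=
  (∀ d ∈ T, IsDomino d) ∧ T.PairwiseDisjoint id ∧ ⋃₀ T = S

/-! Fix a parity and group the four squares around each lattice point of that parity into a cell.
The edge inside a domino has exactly one endpoint of that parity, so every domino lies in one cell.
Every square lies in two cells, centred at an upper and at a lower corner, and a tiling chooses one
of them for it; let `U` be the set of squares that choose the upper one.

Conversely, fix `U`. The squares assigned to a cell can be tiled inside it iff its two diagonals
carry equally many of them: none, two adjacent squares, or all four. The tiling is then unique,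
except that a full cell has two. Hence the number of tilings is the sum of `2 ^ #full cells` over
balanced `U` (`ncard_tilings_eq_sum`).

Use the parity of `n` for the diamonds of orders `n + 1` and `n` alike. Balance forces `U` on the
boundary of the larger diamond (`CellsBalanced.mem_of_boundary`), so complementing `U` inside the
smaller one is a bijection between balanced sets. It exchanges full and empty inner cells, and full
cells exceed empty ones by `n + 1` (`card_fullCells_complement`). This gives the factor `2 ^ (n +
1)` from order `n` to order `n + 1`. -/

/-! ### The Aztec diamond by inequalities. -/

theorem mem_aztecDiamond_iff (n : ℕ) (i j : ℤ) :
    (i, j) ∈ aztecDiamond n ↔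
      i + j < n ∧ j - i < n + 1 ∧ i - j < n + 1 ∧ -i - j < n + 2 := by
  simp only [aztecDiamond, triangularArray, mirrorX, mirrorY, Set.mem_union, Set.mem_image,
    Set.mem_ofPred_eq, Prod.exists, Prod.mk.injEq]
  constructor
  · rintro ((h | ⟨a, b, h, rfl, rfl⟩) | (⟨a, b, h, rfl, rfl⟩ | ⟨_, _, ⟨a, b, h, rfl, rfl⟩, rfl, rfl⟩))
      <;> omega
  · intro h
    rcases le_or_gt 0 i with hi | hi <;> rcases le_or_gt 0 j with hj | hj
    · exact Or.inl (Or.inl (by omega))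
    · exact Or.inr (Or.inl ⟨i, -1 - j, by omega, rfl, by omega⟩)
    · exact Or.inl (Or.inr ⟨-1 - i, j, by omega, by omega, rfl⟩)
    · exact Or.inr (Or.inr ⟨i, -1 - j, ⟨-1 - i, -1 - j, by omega, by omega, rfl⟩, rfl, by omega⟩)

/-- The squares of the Aztec diamond of order `n`, as a finite set. -/
noncomputable def aztecFinset (n : ℕ) : Finset GridSquare :=
  (Finset.Icc (-n : ℤ) n ×ˢ Finset.Icc (-n : ℤ) n).filter fun p =>
    p.1 + p.2 < n ∧ p.2 - p.1 < n + 1 ∧ p.1 - p.2 < n + 1 ∧ -p.1 - p.2 < n + 2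

theorem mem_aztecFinset {n : ℕ} {i j : ℤ} :
    (i, j) ∈ aztecFinset n ↔
      i + j < n ∧ j - i < n + 1 ∧ i - j < n + 1 ∧ -i - j < n + 2 := by
  simp only [aztecFinset, Finset.mem_filter, Finset.mem_product, Finset.mem_Icc]
  omega

theorem coe_aztecFinset (n : ℕ) : (aztecFinset n : Set GridSquare) = aztecDiamond n := by
  ext ⟨i, j⟩
  rw [Finset.mem_coe, mem_aztecFinset, mem_aztecDiamond_iff]

/-! ### Encoding tilings by pairs of finite sets of squares. -/

/-- The horizontal domino with left square `p`. -/
def hDomino (p : GridSquare) : Set GridSquare := {p, (p.1 + 1, p.2)}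

/-- The vertical domino with bottom square `p`. -/
def vDomino (p : GridSquare) : Set GridSquare := {p, (p.1, p.2 + 1)}

theorem mem_hDomino {p q : GridSquare} :
    q ∈ hDomino p ↔ q.2 = p.2 ∧ (q.1 = p.1 ∨ q.1 = p.1 + 1) := by
  simp only [hDomino, Set.mem_insert_iff, Set.mem_singleton_iff, Prod.ext_iff]
  tauto

theorem mem_vDomino {p q : GridSquare} :
    q ∈ vDomino p ↔ q.1 = p.1 ∧ (q.2 = p.2 ∨ q.2 = p.2 + 1) := by
  simp only [vDomino, Set.mem_insert_iff, Set.mem_singleton_iff, Prod.ext_iff]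
  tauto

theorem hDomino_injective : Function.Injective hDomino := by
  intro p q h
  have h1 : p ∈ hDomino q := h ▸ (by simp [hDomino])
  have h2 : q ∈ hDomino p := h ▸ (by simp [hDomino])
  rw [mem_hDomino] at h1 h2
  ext <;> omega

theorem vDomino_injective : Function.Injective vDomino := by
  intro p q h
  have h1 : p ∈ vDomino q := h ▸ (by simp [vDomino])
  have h2 : q ∈ vDomino p := h ▸ (by simp [vDomino])
  rw [mem_vDomino] at h1 h2
  ext <;> omega

theorem hDomino_ne_vDomino (p q : GridSquare) : hDomino p ≠ vDomino q := by
  intro h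
  have h1 : p ∈ vDomino q := h ▸ (by simp [hDomino])
  have h2 : (p.1 + 1, p.2) ∈ vDomino q := h ▸ (by simp [hDomino])
  rw [mem_vDomino] at h1 h2
  simp only at h2
  omega

theorem isDomino_hDomino (p : GridSquare) : IsDomino (hDomino p) :=
  ⟨p, (p.1 + 1, p.2), by simp [AdjacentSquares], rfl⟩

theorem isDomino_vDomino (p : GridSquare) : IsDomino (vDomino p) :=
  ⟨p, (p.1, p.2 + 1), by simp [AdjacentSquares], rfl⟩

theorem IsDomino.eq_hDomino_or_vDomino {d : Set GridSquare} (hd : IsDomino d) :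
    (∃ p, d = hDomino p) ∨ ∃ p, d = vDomino p := by
  obtain ⟨⟨a, b⟩, ⟨c, e⟩, h, rfl⟩ := hd
  simp only [AdjacentSquares] at h
  have key : (c = a + 1 ∧ e = b) ∨ (a = c + 1 ∧ e = b) ∨ (c = a ∧ e = b + 1) ∨
      (c = a ∧ b = e + 1) := by
    rcases abs_cases (a - c) with h1 | h1 <;> rcases abs_cases (b - e) with h2 | h2 <;> omega
  rcases key with ⟨rfl, rfl⟩ | ⟨rfl, rfl⟩ | ⟨rfl, rfl⟩ | ⟨rfl, rfl⟩
  · exact Or.inl ⟨_, rfl⟩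
  · exact Or.inl ⟨(c, e), Set.pair_comm _ _⟩
  · exact Or.inr ⟨_, rfl⟩
  · exact Or.inr ⟨(c, e), Set.pair_comm _ _⟩

/-- The set of dominoes with given left squares (of the horizontal dominoes) and bottom squares
(of the vertical dominoes). -/
def dominoes (D : Finset GridSquare × Finset GridSquare) : Set (Set GridSquare) :=
  hDomino '' D.1 ∪ vDomino '' D.2

theorem hDomino_mem_dominoes {D : Finset GridSquare × Finset GridSquare} {p : GridSquare} :
    hDomino p ∈ dominoes D ↔ p ∈ D.1 := by
  constructor
  · rintro (⟨q, hq, h⟩ | ⟨q, hq, h⟩)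
    · exact hDomino_injective h ▸ hq
    · exact (hDomino_ne_vDomino _ _ h.symm).elim
  · exact fun h => Or.inl ⟨p, h, rfl⟩

theorem vDomino_mem_dominoes {D : Finset GridSquare × Finset GridSquare} {p : GridSquare} :
    vDomino p ∈ dominoes D ↔ p ∈ D.2 := by
  constructor
  · rintro (⟨q, hq, h⟩ | ⟨q, hq, h⟩)
    · exact (hDomino_ne_vDomino _ _ h).elim
    · exact vDomino_injective h ▸ hq
  · exact fun h => Or.inr ⟨p, h, rfl⟩

theorem dominoes_injective : Function.Injective dominoes := by
  intro D E h
  refine Prod.ext (Finset.ext fun p => ?_) (Finset.ext fun p => ?_)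
  · rw [← hDomino_mem_dominoes, ← hDomino_mem_dominoes, h]
  · rw [← vDomino_mem_dominoes, ← vDomino_mem_dominoes, h]

/-- The dominoes encoded by `D` cover the square `(i, j)` at least once. -/
def Covered (D : Finset GridSquare × Finset GridSquare) (i j : ℤ) : Prop :=
  (i, j) ∈ D.1 ∨ (i - 1, j) ∈ D.1 ∨ (i, j) ∈ D.2 ∨ (i, j - 1) ∈ D.2

/-- The dominoes encoded by `D` cover the square `(i, j)` at most once. -/
def CoveredAtMostOnce (D : Finset GridSquare × Finset GridSquare) (i j : ℤ) : Prop :=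
  ¬((i, j) ∈ D.1 ∧ (i - 1, j) ∈ D.1) ∧ ¬((i, j) ∈ D.1 ∧ (i, j) ∈ D.2) ∧
  ¬((i, j) ∈ D.1 ∧ (i, j - 1) ∈ D.2) ∧ ¬((i - 1, j) ∈ D.1 ∧ (i, j) ∈ D.2) ∧
  ¬((i - 1, j) ∈ D.1 ∧ (i, j - 1) ∈ D.2) ∧ ¬((i, j) ∈ D.2 ∧ (i, j - 1) ∈ D.2)

theorem mem_sUnion_dominoes {D : Finset GridSquare × Finset GridSquare} {i j : ℤ} :
    (i, j) ∈ ⋃₀ dominoes D ↔ Covered D i j := by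
  constructor
  · rintro ⟨_, ⟨⟨a, b⟩, hq, rfl⟩ | ⟨⟨a, b⟩, hq, rfl⟩, h⟩
    · rw [mem_hDomino] at h
      obtain ⟨rfl, h | h⟩ := h <;> simp only at h <;> subst h
      · exact Or.inl hq
      · exact Or.inr (Or.inl (by simpa using hq))
    · rw [mem_vDomino] at h
      obtain ⟨rfl, h | h⟩ := h <;> simp only at h <;> subst h
      · exact Or.inr (Or.inr (Or.inl hq))
      · exact Or.inr (Or.inr (Or.inr (by simpa using hq)))
  · rintro (h | h | h | h)
    · exact ⟨_, hDomino_mem_dominoes.2 h, by simp [mem_hDomino]⟩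
    · exact ⟨_, hDomino_mem_dominoes.2 h, by simp [mem_hDomino]⟩
    · exact ⟨_, vDomino_mem_dominoes.2 h, by simp [mem_vDomino]⟩
    · exact ⟨_, vDomino_mem_dominoes.2 h, by simp [mem_vDomino]⟩

theorem pairwiseDisjoint_dominoes_iff {D : Finset GridSquare × Finset GridSquare} :
    (dominoes D).PairwiseDisjoint id ↔ ∀ i j, CoveredAtMostOnce D i j := by
  constructor
  · intro h i j
    have key : ∀ d ∈ dominoes D, ∀ d' ∈ dominoes D, (i, j) ∈ d → (i, j) ∈ d' → d = d' :=
      fun d hd d' hd' h1 h2 => h.elim_set hd hd' (i, j) h1 h2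
    refine ⟨?_, ?_, ?_, ?_, ?_, ?_⟩ <;> rintro ⟨h1, h2⟩
    · have := hDomino_injective (key _ (hDomino_mem_dominoes.2 h1) _ (hDomino_mem_dominoes.2 h2)
        (by simp [mem_hDomino]) (by simp [mem_hDomino]))
      simp only [Prod.mk.injEq] at this
      omega
    · exact hDomino_ne_vDomino _ _ (key _ (hDomino_mem_dominoes.2 h1) _
        (vDomino_mem_dominoes.2 h2) (by simp [mem_hDomino]) (by simp [mem_vDomino]))
    · exact hDomino_ne_vDomino _ _ (key _ (hDomino_mem_dominoes.2 h1) _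
        (vDomino_mem_dominoes.2 h2) (by simp [mem_hDomino]) (by simp [mem_vDomino]))
    · exact hDomino_ne_vDomino _ _ (key _ (hDomino_mem_dominoes.2 h1) _
        (vDomino_mem_dominoes.2 h2) (by simp [mem_hDomino]) (by simp [mem_vDomino]))
    · exact hDomino_ne_vDomino _ _ (key _ (hDomino_mem_dominoes.2 h1) _
        (vDomino_mem_dominoes.2 h2) (by simp [mem_hDomino]) (by simp [mem_vDomino]))
    · have := vDomino_injective (key _ (vDomino_mem_dominoes.2 h1) _ (vDomino_mem_dominoes.2 h2)
        (by simp [mem_vDomino]) (by simp [mem_vDomino]))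
      simp only [Prod.mk.injEq] at this
      omega
  · intro h d hd d' hd' hne
    rw [Function.onFun, Set.disjoint_left]
    rintro ⟨i, j⟩ h1 h2
    apply hne
    obtain ⟨c1, c2, c3, c4, c5, c6⟩ := h i j
    have shape : ∀ d ∈ dominoes D, (i, j) ∈ d →
        (d = hDomino (i, j) ∧ (i, j) ∈ D.1) ∨ (d = hDomino (i - 1, j) ∧ (i - 1, j) ∈ D.1) ∨
        (d = vDomino (i, j) ∧ (i, j) ∈ D.2) ∨ (d = vDomino (i, j - 1) ∧ (i, j - 1) ∈ D.2) := by
      rintro _ (⟨⟨a, b⟩, hq, rfl⟩ | ⟨⟨a, b⟩, hq, rfl⟩) h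
      · rw [mem_hDomino] at h
        obtain ⟨rfl, h | h⟩ := h <;> simp only at h <;> subst h
        · exact Or.inl ⟨rfl, hq⟩
        · exact Or.inr (Or.inl (by simpa using hq))
      · rw [mem_vDomino] at h
        obtain ⟨rfl, h | h⟩ := h <;> simp only at h <;> subst h
        · exact Or.inr (Or.inr (Or.inl ⟨rfl, hq⟩))
        · exact Or.inr (Or.inr (Or.inr (by simpa using hq)))
    rcases shape d hd h1 with ⟨rfl, e1⟩ | ⟨rfl, e1⟩ | ⟨rfl, e1⟩ | ⟨rfl, e1⟩ <;>
      rcases shape d' hd' h2 with ⟨rfl, e2⟩ | ⟨rfl, e2⟩ | ⟨rfl, e2⟩ | ⟨rfl, e2⟩ <;>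
      first | rfl | (exfalso; tauto)

/-- `D` encodes a tiling of the finite set of squares `S`. -/
def EncodesTiling (S : Finset GridSquare) (D : Finset GridSquare × Finset GridSquare) : Prop :=
  ∀ i j, CoveredAtMostOnce D i j ∧ ((i, j) ∈ S ↔ Covered D i j)

theorem isDominoTiling_dominoes_iff {S : Finset GridSquare}
    {D : Finset GridSquare × Finset GridSquare} :
    IsDominoTiling S (dominoes D) ↔ EncodesTiling S D := by
  constructor
  · rintro ⟨-, h1, h2⟩ i j
    refine ⟨pairwiseDisjoint_dominoes_iff.1 h1 i j, ?_⟩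
    rw [← mem_sUnion_dominoes, h2, Finset.mem_coe]
  · intro h
    refine ⟨?_, pairwiseDisjoint_dominoes_iff.2 fun i j => (h i j).1, ?_⟩
    · rintro _ (⟨q, -, rfl⟩ | ⟨q, -, rfl⟩)
      exacts [isDomino_hDomino q, isDomino_vDomino q]
    · ext ⟨i, j⟩
      rw [mem_sUnion_dominoes, Finset.mem_coe, (h i j).2]

open Classical in
theorem IsDominoTiling.exists_eq_dominoes {S : Finset GridSquare} {T : Set (Set GridSquare)}
    (hT : IsDominoTiling S T) :
    ∃ D ∈ S.powerset ×ˢ S.powerset, dominoes D = T := by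
  refine ⟨(S.filter fun p => hDomino p ∈ T, S.filter fun p => vDomino p ∈ T), ?_, ?_⟩
  · simp
  · obtain ⟨h1, -, h3⟩ := hT
    have hS : ∀ p, ∀ d ∈ T, p ∈ d → p ∈ S := fun p d hd hp => by
      rw [← Finset.mem_coe, ← h3]
      exact ⟨d, hd, hp⟩
    ext d
    constructor
    · rintro (⟨q, hq, rfl⟩ | ⟨q, hq, rfl⟩)
      · exact (Finset.mem_filter.1 hq).2
      · exact (Finset.mem_filter.1 hq).2
    · intro hd
      rcases (h1 d hd).eq_hDomino_or_vDomino with ⟨p, rfl⟩ | ⟨p, rfl⟩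
      · exact hDomino_mem_dominoes.2
          (Finset.mem_filter.2 ⟨hS p _ hd (by simp [mem_hDomino]), hd⟩)
      · exact vDomino_mem_dominoes.2
          (Finset.mem_filter.2 ⟨hS p _ hd (by simp [mem_vDomino]), hd⟩)

open Classical in
theorem ncard_tilings_eq_card_encodings (S : Finset GridSquare) :
    {T : Set (Set GridSquare) | IsDominoTiling S T}.ncard =
      ((S.powerset ×ˢ S.powerset).filter (EncodesTiling S)).card := by
  rw [← Set.ncard_coe_finset, ← Set.ncard_image_of_injective _ dominoes_injective]
  congr 1
  ext T
  constructor
  · intro hT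
    obtain ⟨D, hD, rfl⟩ := IsDominoTiling.exists_eq_dominoes hT
    exact ⟨D, Finset.mem_coe.2 (Finset.mem_filter.2 ⟨hD, isDominoTiling_dominoes_iff.1 hT⟩), rfl⟩
  · rintro ⟨D, hD, rfl⟩
    exact isDominoTiling_dominoes_iff.2 (Finset.mem_filter.1 (Finset.mem_coe.1 hD)).2

/-! ### Splitting a tiling into cells. -/

/-- A cell of parity `e` is a lattice point `(x, y)` with `x + y ≡ e` modulo 2, together with the
four squares around it. Each domino lies in exactly one cell. For a set `U` of squares of `S`, each
square of `U` is assigned to the cell at one of its upper corners, and each square of `S \ U` to the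
cell at one of its lower corners. `FitsAt S U D x y` says that the dominoes of `D` in the cell
`(x, y)` cover exactly the squares assigned to it, each of them once. -/
def FitsAt (S U : Finset GridSquare) (D : Finset GridSquare × Finset GridSquare) (x y : ℤ) : Prop :=
  ((x - 1, y - 1) ∈ U ↔ Xor ((x - 1, y - 1) ∈ D.1) ((x - 1, y - 1) ∈ D.2)) ∧
  ((x, y - 1) ∈ U ↔ Xor ((x - 1, y - 1) ∈ D.1) ((x, y - 1) ∈ D.2)) ∧
  (((x - 1, y) ∈ S ∧ (x - 1, y) ∉ U) ↔ Xor ((x - 1, y) ∈ D.1) ((x - 1, y - 1) ∈ D.2)) ∧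
  (((x, y) ∈ S ∧ (x, y) ∉ U) ↔ Xor ((x - 1, y) ∈ D.1) ((x, y - 1) ∈ D.2)) ∧
  ¬((x - 1, y - 1) ∈ D.1 ∧ (x - 1, y - 1) ∈ D.2) ∧
  ¬((x - 1, y - 1) ∈ D.1 ∧ (x, y - 1) ∈ D.2) ∧
  ¬((x - 1, y) ∈ D.1 ∧ (x - 1, y - 1) ∈ D.2) ∧
  ¬((x - 1, y) ∈ D.1 ∧ (x, y - 1) ∈ D.2)

def Fits (e : ℤ) (S U : Finset GridSquare) (D : Finset GridSquare × Finset GridSquare) : Prop :=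
  ∀ x y : ℤ, (x + y - e) % 2 = 0 → FitsAt S U D x y

open Classical in
/-- The squares that the dominoes encoded by `D` cover from the cell at their upper corner. -/
noncomputable def upperSquares (e : ℤ) (S : Finset GridSquare)
    (D : Finset GridSquare × Finset GridSquare) : Finset GridSquare :=
  S.filter fun p => p ∈ D.2 ∨ (p ∈ D.1 ∧ (p.1 + p.2 - e) % 2 = 0) ∨
    ((p.1 - 1, p.2) ∈ D.1 ∧ (p.1 + p.2 - e) % 2 ≠ 0)

theorem mem_upperSquares {e : ℤ} {S : Finset GridSquare}
    {D : Finset GridSquare × Finset GridSquare} {i j : ℤ} :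
    (i, j) ∈ upperSquares e S D ↔ (i, j) ∈ S ∧ ((i, j) ∈ D.2 ∨
      ((i, j) ∈ D.1 ∧ (i + j - e) % 2 = 0) ∨ ((i - 1, j) ∈ D.1 ∧ (i + j - e) % 2 ≠ 0)) := by
  simp [upperSquares]

theorem EncodesTiling.fits {e : ℤ} {S : Finset GridSquare}
    {D : Finset GridSquare × Finset GridSquare} (h : EncodesTiling S D) :
    Fits e S (upperSquares e S D) D := by
  intro x y hxy
  have p1 : (x - 1 + (y - 1) - e) % 2 = 0 := by omega
  have p2 : (x + (y - 1) - e) % 2 ≠ 0 := by omega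
  have p3 : (x - 1 + y - e) % 2 ≠ 0 := by omega
  obtain ⟨⟨a1, a2, a3, a4, a5, a6⟩, a7⟩ := h (x - 1) (y - 1)
  obtain ⟨⟨b1, b2, b3, b4, b5, b6⟩, b7⟩ := h x (y - 1)
  obtain ⟨⟨c1, c2, c3, c4, c5, c6⟩, c7⟩ := h (x - 1) y
  obtain ⟨⟨d1, d2, d3, d4, d5, d6⟩, d7⟩ := h x y
  simp only [Covered] at a7 b7 c7 d7
  simp only [FitsAt, mem_upperSquares, Xor, a7, b7, c7, d7, p1, p2, p3, hxy]
  refine ⟨?_, ?_, ?_, ?_, ?_, ?_, ?_, ?_⟩ <;> grind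

/-- The four dominoes that can contain a square split between its two cells, two in each. Exactly
one of these cells has the square assigned to it and covers it once; the other leaves it uncovered.
-/
theorem Fits.encodesTiling {e : ℤ} {S U : Finset GridSquare}
    {D : Finset GridSquare × Finset GridSquare} (h : Fits e S U D) (hU : U ⊆ S) :
    EncodesTiling S D ∧ upperSquares e S D = U := by
  have key : ∀ i j : ℤ, (CoveredAtMostOnce D i j ∧ ((i, j) ∈ S ↔ Covered D i j)) ∧
      ((i, j) ∈ upperSquares e S D ↔ (i, j) ∈ U) := by
    intro i j
    have hs := @hU (i, j)
    rw [mem_upperSquares]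
    simp only [CoveredAtMostOnce, Covered]
    by_cases p : (i + j - e) % 2 = 0
    · have h1 := h i j p
      have h2 := h (i + 1) (j + 1) (by omega)
      simp only [FitsAt, add_sub_cancel_right, Xor] at h1 h2
      obtain ⟨-, -, -, a4, a5, a6, a7, a8⟩ := h1
      obtain ⟨b1, -, -, -, b5, b6, b7, b8⟩ := h2
      simp only [p]
      refine ⟨⟨?_, ?_⟩, ?_⟩ <;> grind
    · have h1 := h (i + 1) j (by omega)
      have h2 := h i (j + 1) (by omega)
      simp only [FitsAt, add_sub_cancel_right, Xor] at h1 h2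
      obtain ⟨-, -, a3, -, a5, a6, a7, a8⟩ := h1
      obtain ⟨-, b2, -, -, b5, b6, b7, b8⟩ := h2
      simp only [p]
      refine ⟨⟨?_, ?_⟩, ?_⟩ <;> grind
  exact ⟨fun i j => (key i j).1, Finset.ext fun ⟨i, j⟩ => (key i j).2⟩

/-! ### Balanced assignments and full cells. -/

/-- In each cell, as many assigned squares lie on one diagonal as on the other. -/
def CellsBalanced (e : ℤ) (S U : Finset GridSquare) : Prop :=
  ∀ x y : ℤ, (x + y - e) % 2 = 0 →
    (((x - 1, y - 1) ∈ U ∧ ((x, y) ∈ S ∧ (x, y) ∉ U) ↔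
      (x, y - 1) ∈ U ∧ ((x - 1, y) ∈ S ∧ (x - 1, y) ∉ U)) ∧
    ((x - 1, y - 1) ∈ U ∨ ((x, y) ∈ S ∧ (x, y) ∉ U) ↔
      (x, y - 1) ∈ U ∨ ((x - 1, y) ∈ S ∧ (x - 1, y) ∉ U)))

theorem Fits.balanced {e : ℤ} {S U : Finset GridSquare}
    {D : Finset GridSquare × Finset GridSquare} (h : Fits e S U D) : CellsBalanced e S U := by
  intro x y hxy
  obtain ⟨a1, a2, a3, a4, a5, a6, a7, a8⟩ := h x y hxy
  rw [a1, a2, a3, a4]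
  simp only [Xor]
  constructor <;> grind

open Classical in
/-- The cells all of whose four squares are assigned to them. -/
noncomputable def fullCells (e : ℤ) (S U : Finset GridSquare) : Finset (ℤ × ℤ) :=
  S.filter fun c => (c.1 + c.2 - e) % 2 = 0 ∧ (c.1 - 1, c.2 - 1) ∈ U ∧ (c.1, c.2 - 1) ∈ U ∧
    ((c.1 - 1, c.2) ∈ S ∧ (c.1 - 1, c.2) ∉ U) ∧ c ∉ U

theorem mem_fullCells {e : ℤ} {S U : Finset GridSquare} {x y : ℤ} :
    (x, y) ∈ fullCells e S U ↔ (x + y - e) % 2 = 0 ∧ (x - 1, y - 1) ∈ U ∧ (x, y - 1) ∈ U ∧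
      ((x - 1, y) ∈ S ∧ (x - 1, y) ∉ U) ∧ ((x, y) ∈ S ∧ (x, y) ∉ U) := by
  simp only [fullCells, Finset.mem_filter]
  tauto

open Classical in
/-- The dominoes that cover in each cell the squares assigned to it, where the full cells in `B`
are covered by horizontal dominoes and the other full cells by vertical ones. -/
noncomputable def dominoesOf (e : ℤ) (S U : Finset GridSquare) (B : Finset (ℤ × ℤ)) :
    Finset GridSquare × Finset GridSquare :=
  (S.filter fun p =>
    ((p.1 + p.2 - e) % 2 = 0 ∧ p ∈ U ∧ (p.1 + 1, p.2) ∈ U ∧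
      ((p.1 + 1, p.2 + 1) ∈ fullCells e S U → (p.1 + 1, p.2 + 1) ∈ B)) ∨
    ((p.1 + p.2 - e) % 2 ≠ 0 ∧ p ∉ U ∧ ((p.1 + 1, p.2) ∈ S ∧ (p.1 + 1, p.2) ∉ U) ∧
      ((p.1 + 1, p.2) ∈ fullCells e S U → (p.1 + 1, p.2) ∈ B)),
   S.filter fun p =>
    ((p.1 + p.2 - e) % 2 = 0 ∧ p ∈ U ∧ ((p.1, p.2 + 1) ∈ S ∧ (p.1, p.2 + 1) ∉ U) ∧
      ¬((p.1 + 1, p.2 + 1) ∈ fullCells e S U ∧ (p.1 + 1, p.2 + 1) ∈ B)) ∨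
    ((p.1 + p.2 - e) % 2 ≠ 0 ∧ p ∈ U ∧ ((p.1, p.2 + 1) ∈ S ∧ (p.1, p.2 + 1) ∉ U) ∧
      ¬((p.1, p.2 + 1) ∈ fullCells e S U ∧ (p.1, p.2 + 1) ∈ B)))

section dominoesOf

variable {e : ℤ} {S U : Finset GridSquare} {B : Finset (ℤ × ℤ)} {x y : ℤ}

/-- This and the next three lemmas describe the four dominoes of one cell relative to its centre,
which removes the case split on parity. -/
theorem southWest_mem_dominoesOf_fst (hU : U ⊆ S) (h : (x + y - e) % 2 = 0) :
    (x - 1, y - 1) ∈ (dominoesOf e S U B).1 ↔ (x - 1, y - 1) ∈ U ∧ (x, y - 1) ∈ U ∧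
      ((x, y) ∈ fullCells e S U → (x, y) ∈ B) := by
  have hs := @hU (x - 1, y - 1)
  have p : (x - 1 + (y - 1) - e) % 2 = 0 := by omega
  simp only [dominoesOf, Finset.mem_filter, p, sub_add_cancel]
  tauto

theorem northWest_mem_dominoesOf_fst (h : (x + y - e) % 2 = 0) :
    (x - 1, y) ∈ (dominoesOf e S U B).1 ↔ ((x - 1, y) ∈ S ∧ (x - 1, y) ∉ U) ∧
      ((x, y) ∈ S ∧ (x, y) ∉ U) ∧ ((x, y) ∈ fullCells e S U → (x, y) ∈ B) := by
  have p : (x - 1 + y - e) % 2 ≠ 0 := by omega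
  simp only [dominoesOf, Finset.mem_filter, p, sub_add_cancel]
  tauto

theorem southWest_mem_dominoesOf_snd (hU : U ⊆ S) (h : (x + y - e) % 2 = 0) :
    (x - 1, y - 1) ∈ (dominoesOf e S U B).2 ↔ (x - 1, y - 1) ∈ U ∧
      ((x - 1, y) ∈ S ∧ (x - 1, y) ∉ U) ∧ ¬((x, y) ∈ fullCells e S U ∧ (x, y) ∈ B) := by
  have hs := @hU (x - 1, y - 1)
  have p : (x - 1 + (y - 1) - e) % 2 = 0 := by omega
  simp only [dominoesOf, Finset.mem_filter, p, sub_add_cancel]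
  tauto

theorem southEast_mem_dominoesOf_snd (hU : U ⊆ S) (h : (x + y - e) % 2 = 0) :
    (x, y - 1) ∈ (dominoesOf e S U B).2 ↔ (x, y - 1) ∈ U ∧
      ((x, y) ∈ S ∧ (x, y) ∉ U) ∧ ¬((x, y) ∈ fullCells e S U ∧ (x, y) ∈ B) := by
  have hs := @hU (x, y - 1)
  have p : (x + (y - 1) - e) % 2 ≠ 0 := by omega
  simp only [dominoesOf, Finset.mem_filter, p, sub_add_cancel]
  tauto

theorem fits_dominoesOf (hU : U ⊆ S) (hb : CellsBalanced e S U) :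
    Fits e S U (dominoesOf e S U B) := by
  intro x y h
  obtain ⟨h1, h2⟩ := hb x y h
  have hf := @mem_fullCells e S U x y
  simp only [FitsAt, southWest_mem_dominoesOf_fst hU h, northWest_mem_dominoesOf_fst h,
    southWest_mem_dominoesOf_snd hU h, southEast_mem_dominoesOf_snd hU h, Xor]
  simp only [h, true_and] at hf
  -- Only a propositional statement about one cell remains: `a`, `b`, `c`, `d` say which of its
  -- squares are assigned to it.
  generalize ((x, y) ∈ fullCells e S U) = F at *
  generalize ((x - 1, y - 1) ∈ U) = a at *
  generalize ((x, y - 1) ∈ U) = b at *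
  generalize ((x - 1, y) ∈ S ∧ (x - 1, y) ∉ U) = c at *
  generalize ((x, y) ∈ S ∧ (x, y) ∉ U) = d at *
  generalize ((x, y) ∈ B) = E at *
  clear hU hb
  refine ⟨?_, ?_, ?_, ?_, ?_, ?_, ?_, ?_⟩ <;> grind

/-- Outside the full cells the dominoes are forced. In a full cell, whether the lower left square
starts a horizontal domino decides between the two tilings. -/
theorem Fits.eq_dominoesOf {D : Finset GridSquare × Finset GridSquare} (hU : U ⊆ S)
    (h : Fits e S U D) (hB : ∀ x y, (x, y) ∈ fullCells e S U →
      ((x, y) ∈ B ↔ (x - 1, y - 1) ∈ D.1)) :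
    dominoesOf e S U B = D := by
  have key : ∀ x y : ℤ, (x + y - e) % 2 = 0 →
      ((x - 1, y - 1) ∈ (dominoesOf e S U B).1 ↔ (x - 1, y - 1) ∈ D.1) ∧
      ((x - 1, y) ∈ (dominoesOf e S U B).1 ↔ (x - 1, y) ∈ D.1) ∧
      ((x - 1, y - 1) ∈ (dominoesOf e S U B).2 ↔ (x - 1, y - 1) ∈ D.2) ∧
      ((x, y - 1) ∈ (dominoesOf e S U B).2 ↔ (x, y - 1) ∈ D.2) := by
    intro x y hxy
    have hf := @mem_fullCells e S U x y
    have hB' := hB x y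
    obtain ⟨a1, a2, a3, a4, a5, a6, a7, a8⟩ := h x y hxy
    rw [southWest_mem_dominoesOf_fst hU hxy, northWest_mem_dominoesOf_fst hxy,
      southWest_mem_dominoesOf_snd hU hxy, southEast_mem_dominoesOf_snd hU hxy]
    rw [a1, a2, a3, a4]
    rw [a1, a2, a3, a4] at hf
    simp only [hxy, true_and, Xor] at hf ⊢
    generalize ((x, y) ∈ fullCells e S U) = F at *
    clear hU h hB a1 a2 a3 a4
    refine ⟨?_, ?_, ?_, ?_⟩ <;> grind
  refine Prod.ext (Finset.ext fun ⟨i, j⟩ => ?_) (Finset.ext fun ⟨i, j⟩ => ?_)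
  · by_cases p : (i + j - e) % 2 = 0
    · simpa using (key (i + 1) (j + 1) (by omega)).1
    · simpa using (key (i + 1) j (by omega)).2.1
  · by_cases p : (i + j - e) % 2 = 0
    · simpa using (key (i + 1) (j + 1) (by omega)).2.2.1
    · simpa using (key i (j + 1) (by omega)).2.2.2

end dominoesOf

theorem EncodesTiling.mem_powerset {S : Finset GridSquare}
    {D : Finset GridSquare × Finset GridSquare} (h : EncodesTiling S D) :
    D ∈ S.powerset ×ˢ S.powerset := by
  rw [Finset.mem_product, Finset.mem_powerset, Finset.mem_powerset]
  exact ⟨fun ⟨i, j⟩ hp => (h i j).2.2 (Or.inl hp),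
    fun ⟨i, j⟩ hp => (h i j).2.2 (Or.inr (Or.inr (Or.inl hp)))⟩

open Classical in
/-- The tilings in which the squares covered from above are those of `U` correspond to the sets
of full cells. -/
theorem card_encodings_upperSquares_eq {e : ℤ} {S U : Finset GridSquare} (hU : U ⊆ S)
    (hb : CellsBalanced e S U) :
    (((S.powerset ×ˢ S.powerset).filter (EncodesTiling S)).filter
      fun D => upperSquares e S D = U).card = 2 ^ (fullCells e S U).card := by
  rw [← Finset.card_powerset]
  refine Finset.card_nbij'
    (fun D => (fullCells e S U).filter fun c => (c.1 - 1, c.2 - 1) ∈ D.1)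
    (dominoesOf e S U) ?_ ?_ ?_ ?_
  · intro D _
    rw [Finset.mem_coe, Finset.mem_powerset]
    exact Finset.filter_subset _ _
  · intro B _
    obtain ⟨h1, h2⟩ := (fits_dominoesOf (B := B) hU hb).encodesTiling hU
    simp only [Finset.coe_filter, Finset.mem_filter, Set.mem_ofPred_eq]
    exact ⟨⟨h1.mem_powerset, h1⟩, h2⟩
  · intro D hD
    simp only [Finset.coe_filter, Finset.mem_filter, Set.mem_ofPred_eq] at hD
    obtain ⟨⟨-, h1⟩, rfl⟩ := hD
    refine h1.fits.eq_dominoesOf hU fun x y h => ?_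
    simp [h]
  · intro B hB
    have hB' : B ⊆ fullCells e S U := by simpa using hB
    ext ⟨x, y⟩
    rw [Finset.mem_filter]
    constructor
    · rintro ⟨h1, h2⟩
      exact ((southWest_mem_dominoesOf_fst hU (mem_fullCells.1 h1).1).1 h2).2.2 h1
    · intro h
      have h1 := mem_fullCells.1 (hB' h)
      exact ⟨hB' h, (southWest_mem_dominoesOf_fst hU h1.1).2 ⟨h1.2.1, h1.2.2.1, fun _ => h⟩⟩

open Classical in
theorem ncard_tilings_eq_sum (e : ℤ) (S : Finset GridSquare) :
    {T : Set (Set GridSquare) | IsDominoTiling S T}.ncard =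
      ∑ U ∈ S.powerset.filter (CellsBalanced e S), 2 ^ (fullCells e S U).card := by
  rw [ncard_tilings_eq_card_encodings, Finset.card_eq_sum_card_fiberwise
    (f := upperSquares e S) (t := S.powerset.filter (CellsBalanced e S))]
  · refine Finset.sum_congr rfl fun U hU => ?_
    rw [Finset.mem_filter, Finset.mem_powerset] at hU
    exact card_encodings_upperSquares_eq hU.1 hU.2
  · intro D hD
    have h := (Finset.mem_filter.1 (Finset.mem_coe.1 hD)).2
    rw [Finset.mem_coe, Finset.mem_filter, Finset.mem_powerset]
    exact ⟨Finset.filter_subset _ _, h.fits.balanced⟩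

/-! ### Complementation between the diamonds of orders `n + 1` and `n`. -/

/-- The cell at the outward corner of a boundary square contains no other square of the larger
diamond. A single assigned square would unbalance it, so the boundary square is assigned to its
inward corner: the lower one above the axis, the upper one below it. -/
theorem CellsBalanced.mem_of_boundary {n : ℕ} {U : Finset GridSquare}
    (hU : U ⊆ aztecFinset (n + 1)) (hb : CellsBalanced n (aztecFinset (n + 1)) U) {i j : ℤ}
    (h1 : (i, j) ∈ aztecFinset (n + 1)) (h2 : (i, j) ∉ aztecFinset n) :
    (i, j) ∈ U ↔ j < 0 := by
  have hU' : ∀ a b : ℤ, (a, b) ∉ aztecFinset (n + 1) → (a, b) ∉ U := fun a b h h' => h (hU h')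
  simp only [mem_aztecFinset, Nat.cast_add, Nat.cast_one] at h1 h2 hU'
  have hcases : (0 ≤ j ∧ i + j = n) ∨ (0 ≤ j ∧ j - i = n + 1) ∨ (j < 0 ∧ i - j = n + 1) ∨
      (j < 0 ∧ -i - j = n + 2) := by omega
  rcases hcases with ⟨hj, h⟩ | ⟨hj, h⟩ | ⟨hj, h⟩ | ⟨hj, h⟩
  · have hc := hb (i + 1) (j + 1) (by omega)
    have u1 := hU' (i + 1) j (by omega)
    simp only [add_sub_cancel_right, mem_aztecFinset, Nat.cast_add, Nat.cast_one] at hc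
    have s1 : ¬ (i + (j + 1) < (n : ℤ) + 1) := by omega
    have hj' : ¬ j < 0 := by omega
    grind
  · have hc := hb i (j + 1) (by omega)
    have u1 := hU' (i - 1) j (by omega)
    simp only [add_sub_cancel_right, mem_aztecFinset, Nat.cast_add, Nat.cast_one] at hc
    have s1 : ¬ (j + 1 - i < (n : ℤ) + 1 + 1) := by omega
    have hj' : ¬ j < 0 := by omega
    grind
  · have hc := hb (i + 1) j (by omega)
    have u1 := hU' (i + 1) (j - 1) (by omega)
    have u2 := hU' i (j - 1) (by omega)
    simp only [add_sub_cancel_right, mem_aztecFinset, Nat.cast_add, Nat.cast_one] at hc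
    have s1 : ¬ (i + 1 - j < (n : ℤ) + 1 + 1) := by omega
    grind
  · have hc := hb i j (by omega)
    have u1 := hU' (i - 1) (j - 1) (by omega)
    have u2 := hU' i (j - 1) (by omega)
    simp only [mem_aztecFinset, Nat.cast_add, Nat.cast_one] at hc
    have s1 : ¬ (-(i - 1) - j < (n : ℤ) + 1 + 2) := by omega
    grind

/-- The cells of parity `n` that meet the Aztec diamond of order `n`; all their squares lie in the
Aztec diamond of order `n + 1`. -/
def InnerCell (n : ℕ) (x y : ℤ) : Prop :=
  x + y ≤ n ∧ y - x ≤ n ∧ x - y ≤ n ∧ -x - y ≤ n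

/-- `U` agrees with the lower half plane on the boundary squares of the Aztec diamond of order
`n + 1`. -/
def AgreesOnBoundary (n : ℕ) (U : Finset GridSquare) : Prop :=
  ∀ i j : ℤ, (i, j) ∈ aztecFinset (n + 1) → (i, j) ∉ aztecFinset n → ((i, j) ∈ U ↔ j < 0)

section complement

variable {n : ℕ} {U V : Finset GridSquare} {x y : ℤ}

/-- Passing from `U` to the complement in the smaller Aztec diamond complements the set of squares
assigned to an inner cell. -/
theorem InnerCell.mem_complement_iff (hc : InnerCell n x y)
    (hU : AgreesOnBoundary n U) (hV : ∀ p, p ∈ V ↔ p ∈ aztecFinset n ∧ p ∉ U) :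
    ((x - 1, y - 1) ∈ V ↔ (x - 1, y - 1) ∉ U) ∧ ((x, y - 1) ∈ V ↔ (x, y - 1) ∉ U) ∧
    (((x - 1, y) ∈ aztecFinset n ∧ (x - 1, y) ∉ V) ↔
      ¬((x - 1, y) ∈ aztecFinset (n + 1) ∧ (x - 1, y) ∉ U)) ∧
    (((x, y) ∈ aztecFinset n ∧ (x, y) ∉ V) ↔
      ¬((x, y) ∈ aztecFinset (n + 1) ∧ (x, y) ∉ U)) := by
  obtain ⟨c1, c2, c3, c4⟩ := hc
  have m1 : (x - 1, y - 1) ∈ aztecFinset (n + 1) := by rw [mem_aztecFinset]; push_cast; omega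
  have m2 : (x, y - 1) ∈ aztecFinset (n + 1) := by rw [mem_aztecFinset]; push_cast; omega
  have m3 : (x - 1, y) ∈ aztecFinset (n + 1) := by rw [mem_aztecFinset]; push_cast; omega
  have m4 : (x, y) ∈ aztecFinset (n + 1) := by rw [mem_aztecFinset]; push_cast; omega
  have b1 := hU _ _ m1
  have b2 := hU _ _ m2
  have b3 := hU _ _ m3
  have b4 := hU _ _ m4
  have t1 : (x - 1, y - 1) ∉ aztecFinset n → y - 1 < 0 := by rw [mem_aztecFinset]; omega
  have t2 : (x, y - 1) ∉ aztecFinset n → y - 1 < 0 := by rw [mem_aztecFinset]; omega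
  have t3 : (x - 1, y) ∉ aztecFinset n → ¬ y < 0 := by rw [mem_aztecFinset]; omega
  have t4 : (x, y) ∉ aztecFinset n → ¬ y < 0 := by rw [mem_aztecFinset]; omega
  simp only [hV]
  grind

theorem not_mem_of_not_innerCell (hxy : (x + y - n) % 2 = 0) (hc : ¬ InnerCell n x y) :
    (x - 1, y - 1) ∉ aztecFinset n ∧ (x, y - 1) ∉ aztecFinset n ∧ (x - 1, y) ∉ aztecFinset n ∧
      (x, y) ∉ aztecFinset n := by
  simp only [mem_aztecFinset, InnerCell] at *
  omega

/-- In an inner cell, negating all four assignments interchanges the two conditions of balance. The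
other cells contain no square of the smaller diamond. -/
theorem CellsBalanced.complement (hb : CellsBalanced n (aztecFinset (n + 1)) U)
    (hU : AgreesOnBoundary n U) (hV : ∀ p, p ∈ V ↔ p ∈ aztecFinset n ∧ p ∉ U) :
    CellsBalanced n (aztecFinset n) V := by
  intro x y hxy
  have h := hb x y hxy
  by_cases hc : InnerCell n x y
  · obtain ⟨h1, h2, h3, h4⟩ := hc.mem_complement_iff hU hV
    rw [h1, h2, h3, h4]
    grind
  · have h' := not_mem_of_not_innerCell hxy hc
    simp only [hV]
    grind

theorem CellsBalanced.of_complement (hb : CellsBalanced n (aztecFinset n) V)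
    (hS : U ⊆ aztecFinset (n + 1))
    (hU : AgreesOnBoundary n U) (hV : ∀ p, p ∈ V ↔ p ∈ aztecFinset n ∧ p ∉ U) :
    CellsBalanced n (aztecFinset (n + 1)) U := by
  intro x y hxy
  have h := hb x y hxy
  by_cases hc : InnerCell n x y
  · obtain ⟨h1, h2, h3, h4⟩ := hc.mem_complement_iff hU hV
    rw [h1, h2, h3, h4] at h
    grind
  · obtain ⟨h1, h2, h3, h4⟩ := not_mem_of_not_innerCell hxy hc
    -- Boundary agreement assigns nothing to a cell that is not inner.
    have key : (x - 1, y - 1) ∉ U ∧ (x, y - 1) ∉ U ∧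
        ((x - 1, y) ∈ aztecFinset (n + 1) → (x - 1, y) ∈ U) ∧
        ((x, y) ∈ aztecFinset (n + 1) → (x, y) ∈ U) := by
      refine ⟨fun h => ?_, fun h => ?_, fun h => ?_, fun h => ?_⟩
      · have := (hU _ _ (hS h) h1).1 h
        have := hS h
        simp only [mem_aztecFinset, InnerCell, Nat.cast_add, Nat.cast_one] at *
        omega
      · have := (hU _ _ (hS h) h2).1 h
        have := hS h
        simp only [mem_aztecFinset, InnerCell, Nat.cast_add, Nat.cast_one] at *
        omega
      · rw [hU _ _ h h3]
        simp only [mem_aztecFinset, InnerCell, Nat.cast_add, Nat.cast_one] at *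
        omega
      · rw [hU _ _ h h4]
        simp only [mem_aztecFinset, InnerCell, Nat.cast_add, Nat.cast_one] at *
        omega
    grind

end complement

/-! ### Counting full and empty cells. -/

open Classical in
/-- The inner cells of parity `n`. -/
noncomputable def innerCells (n : ℕ) : Finset (ℤ × ℤ) :=
  (aztecFinset (n + 1)).filter fun c => (c.1 + c.2 - (n : ℤ)) % 2 = 0 ∧ InnerCell n c.1 c.2

open Classical in
theorem mem_innerCells {n : ℕ} {x y : ℤ} :
    (x, y) ∈ innerCells n ↔ (x + y - n) % 2 = 0 ∧ InnerCell n x y := by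
  rw [innerCells, Finset.mem_filter, mem_aztecFinset, InnerCell]
  push_cast
  omega

open Classical in
/-- The squares of the Aztec diamond of order `n + 1` with the parity of the inner cells. -/
theorem card_evenSquares (n : ℕ) :
    ((aztecFinset (n + 1)).filter fun p => (p.1 + p.2 - (n : ℤ)) % 2 = 0).card =
      (innerCells n).card + (n + 1) := by
  -- Parity sharpens the bounds of the larger diamond to those of an inner cell, except on the lower
  -- left side, where the line `i + j = -n - 2` contributes `n + 1` further squares.
  have h : ((aztecFinset (n + 1)).filter fun p => (p.1 + p.2 - (n : ℤ)) % 2 = 0) =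
      innerCells n ∪ (Finset.Ico (-(n : ℤ) - 1) 0).image fun i => (i, -(n : ℤ) - 2 - i) := by
    ext ⟨i, j⟩
    simp only [Finset.mem_union, mem_innerCells, Finset.mem_filter, mem_aztecFinset, InnerCell,
      Finset.mem_image, Finset.mem_Ico, Prod.mk.injEq]
    push_cast
    omega
  rw [h, Finset.card_union_of_disjoint, Finset.card_image_of_injective, Int.card_Ico]
  · congr 1
    omega
  · intro a b hab
    exact (Prod.mk.inj hab).1
  · rw [Finset.disjoint_left]
    rintro ⟨x, y⟩ h1 h2
    simp only [mem_innerCells, InnerCell, Finset.mem_image, Prod.mk.injEq] at h1 h2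
    obtain ⟨a, -, rfl, rfl⟩ := h2
    omega

open Classical in
/-- The full cells for `U` outnumber those for the complement of `U` by `n + 1`. -/
theorem card_fullCells_complement {n : ℕ} {U V : Finset GridSquare}
    (hS : U ⊆ aztecFinset (n + 1)) (hb : CellsBalanced n (aztecFinset (n + 1)) U)
    (hV : ∀ p, p ∈ V ↔ p ∈ aztecFinset n ∧ p ∉ U) :
    (fullCells n (aztecFinset (n + 1)) U).card =
      (n + 1) + (fullCells n (aztecFinset n) V).card := by
  have hU : AgreesOnBoundary n U := fun i j => hb.mem_of_boundary hS
  -- `P` and `Q` record whether the lower left and the upper right square are assigned to the cell.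
  -- By balance this diagonal alone detects full cells (both) and empty cells (neither).
  set P := (innerCells n).filter fun c => (c.1 - 1, c.2 - 1) ∈ U with hP
  set Q := (innerCells n).filter fun c => c ∉ U with hQ
  have mem_S : ∀ x y, (x, y) ∈ innerCells n → (x, y) ∈ aztecFinset (n + 1) := fun x y h => by
    rw [mem_innerCells] at h
    simp only [InnerCell, mem_aztecFinset] at *
    push_cast
    omega
  have inter : P ∩ Q = fullCells n (aztecFinset (n + 1)) U := by
    ext ⟨x, y⟩
    have m := mem_S x y
    simp only [hP, hQ, Finset.mem_inter, Finset.mem_filter, mem_fullCells]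
    constructor
    · rintro ⟨⟨h1, h2⟩, -, h3⟩
      have h4 := (mem_innerCells.1 h1).1
      have := hb x y h4
      grind
    · rintro ⟨h1, h2, h3, h4, h5⟩
      have : (x, y) ∈ innerCells n := by
        rw [mem_innerCells]
        refine ⟨h1, ?_⟩
        have g2 := hS h2
        have g3 := hS h3
        simp only [InnerCell, mem_aztecFinset, Nat.cast_add, Nat.cast_one] at *
        omega
      grind
  have compl : innerCells n \ (P ∪ Q) = fullCells n (aztecFinset n) V := by
    ext ⟨x, y⟩
    have m := mem_S x y
    simp only [hP, hQ, Finset.mem_sdiff, Finset.mem_union, Finset.mem_filter, mem_fullCells]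
    by_cases hxy : ((x + y - n) % 2 = 0)
    · have h := hb x y hxy
      by_cases hc : InnerCell n x y
      · obtain ⟨h1, h2, h3, h4⟩ := hc.mem_complement_iff hU hV
        have : (x, y) ∈ innerCells n := mem_innerCells.2 ⟨hxy, hc⟩
        rw [h1, h2, h3, h4]
        grind
      · have h' := not_mem_of_not_innerCell hxy hc
        simp only [mem_innerCells]
        grind
    · simp only [mem_innerCells]
      grind
  have cardPQ : P.card + Q.card = (innerCells n).card + (n + 1) := by
    -- Each square of parity `n` is counted once: in `P`, through the cell at its upper right
    -- corner, if it is in `U`; in `Q`, through the cell at its lower left corner, if not. The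
    -- boundary values of `U` make these cells inner.
    rw [← card_evenSquares, ← Finset.card_filter_add_card_filter_not
      (s := (aztecFinset (n + 1)).filter _) (fun p => p ∈ U)]
    congr 1
    · refine Finset.card_nbij' (fun c => (c.1 - 1, c.2 - 1)) (fun p => (p.1 + 1, p.2 + 1))
        ?_ ?_ ?_ ?_
      · rintro ⟨x, y⟩ h
        simp only [hP, Finset.mem_coe, Finset.mem_filter, mem_innerCells] at h ⊢
        exact ⟨⟨hS h.2, by omega⟩, h.2⟩
      · rintro ⟨x, y⟩ h
        simp only [hP, Finset.mem_coe, Finset.mem_filter, mem_innerCells, add_sub_cancel_right] at h ⊢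
        refine ⟨⟨by omega, ?_⟩, h.2⟩
        have h2 := hU x y h.1.1
        have h3 := h.1.1
        have h4 := h.2
        have h5 := h.1.2
        simp only [InnerCell, mem_aztecFinset, h4, true_iff, Nat.cast_add, Nat.cast_one] at h2 h3 ⊢
        omega
      · rintro ⟨x, y⟩ h
        simp
      · rintro ⟨x, y⟩ h
        simp
    · congr 1
      ext ⟨x, y⟩
      have m := mem_S x y
      simp only [hQ, Finset.mem_filter]
      constructor
      · rintro ⟨h1, h2⟩
        exact ⟨⟨m h1, (mem_innerCells.1 h1).1⟩, h2⟩
      · rintro ⟨⟨h1, h2⟩, h3⟩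
        refine ⟨mem_innerCells.2 ⟨h2, ?_⟩, h3⟩
        have h4 := hU x y h1
        simp only [InnerCell, mem_aztecFinset, h3, false_iff, Nat.cast_add, Nat.cast_one] at h1 h4 ⊢
        omega
  have sub : P ∪ Q ⊆ innerCells n :=
    Finset.union_subset (Finset.filter_subset _ _) (Finset.filter_subset _ _)
  have h1 := Finset.card_union_add_card_inter P Q
  have h2 := Finset.card_sdiff_add_card_eq_card sub
  rw [inter] at h1
  rw [compl] at h2
  omega

/-! ### The recurrence and the final count. -/

open Classical in
theorem ncard_tilings_aztecFinset_succ (n : ℕ) :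
    {T : Set (Set GridSquare) | IsDominoTiling (aztecFinset (n + 1)) T}.ncard =
      2 ^ (n + 1) * {T : Set (Set GridSquare) | IsDominoTiling (aztecFinset n) T}.ncard := by
  have mono : ∀ p, p ∈ aztecFinset n → p ∈ aztecFinset (n + 1) := by
    rintro ⟨i, j⟩ h
    simp only [mem_aztecFinset] at *
    push_cast
    omega
  rw [ncard_tilings_eq_sum n, ncard_tilings_eq_sum n, Finset.mul_sum]
  -- The inverse complements again and restores the forced boundary values: the boundary squares
  -- below the axis.
  refine Finset.sum_nbij' (fun U => aztecFinset n \ U)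
    (fun V => (aztecFinset n \ V) ∪
      (aztecFinset (n + 1) \ aztecFinset n).filter fun p => p.2 < 0) ?_ ?_ ?_ ?_ ?_
  · intro U hU
    rw [Finset.mem_filter, Finset.mem_powerset] at hU ⊢
    exact ⟨Finset.sdiff_subset, hU.2.complement (fun i j => hU.2.mem_of_boundary hU.1)
      fun p => Finset.mem_sdiff⟩
  · intro V hV
    rw [Finset.mem_filter, Finset.mem_powerset] at hV ⊢
    have hS : (aztecFinset n \ V) ∪ (aztecFinset (n + 1) \ aztecFinset n).filter
        (fun p => p.2 < 0) ⊆ aztecFinset (n + 1) := by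
      intro p hp
      have := mono p
      simp only [Finset.mem_union, Finset.mem_sdiff, Finset.mem_filter] at hp
      grind
    refine ⟨hS, hV.2.of_complement hS (fun i j h1 h2 => ?_) fun p => ?_⟩
    · simp [h1, h2]
    · have := @hV.1 p
      simp only [Finset.mem_union, Finset.mem_sdiff, Finset.mem_filter]
      grind
  · intro U hU
    rw [Finset.mem_filter, Finset.mem_powerset] at hU
    ext ⟨i, j⟩
    have h1 := @hU.1 (i, j)
    have h2 := fun h h' => hU.2.mem_of_boundary hU.1 (i := i) (j := j) h h'
    simp only [Finset.mem_union, Finset.mem_sdiff, Finset.mem_filter]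
    grind
  · intro V hV
    rw [Finset.mem_filter, Finset.mem_powerset] at hV
    ext p
    have h1 := @hV.1 p
    simp only [Finset.mem_union, Finset.mem_sdiff, Finset.mem_filter]
    grind
  · intro U hU
    rw [Finset.mem_filter, Finset.mem_powerset] at hU
    rw [card_fullCells_complement hU.1 hU.2 fun p => Finset.mem_sdiff, pow_add]

theorem ncard_tilings_empty :
    {T : Set (Set GridSquare) | IsDominoTiling ∅ T}.ncard = 1 := by
  rw [Set.ncard_eq_one]
  refine ⟨∅, Set.eq_singleton_iff_unique_mem.2 ⟨by simp [IsDominoTiling], ?_⟩⟩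
  rintro T ⟨h1, -, h3⟩
  refine Set.eq_empty_of_forall_notMem fun d hd => ?_
  obtain ⟨p, q, -, rfl⟩ := h1 d hd
  exact Set.notMem_empty p (h3 ▸ ⟨_, hd, by simp⟩)

theorem mainTheorem3 (n : ℕ) :
    {T : Set (Set GridSquare) | IsDominoTiling (aztecDiamond n) T}.ncard =
      2 ^ ((n + 1).choose 2) := by
  rw [← coe_aztecFinset]
  induction n with
  | zero =>
    have h : (aztecFinset 0 : Set GridSquare) = ∅ := by
      ext ⟨i, j⟩
      simp only [Finset.mem_coe, mem_aztecFinset, Set.mem_empty_iff_false, iff_false]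
      push_cast
      omega
    rw [h, ncard_tilings_empty]
    rfl
  | succ n ih =>
    rw [ncard_tilings_aztecFinset_succ, ih, ← pow_add, Nat.choose_succ_succ' (n + 1) 1,
      Nat.choose_one_right]
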